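/- Let $H$ be a finitely generated group (the trivial group is allowed) and let $\langle t\rangle \cong C_\infty$ be an infinite cyclic group. Let $G = H \wr \langle t\rangle = N \rtimes \langle t\rangle$ be their restricted standard wreath product, with base group $N = \bigoplus_{i\in\mathbb{Z}} H^{t^i}$, the direct sum of the conjugates $H^{t^i} = t^{-i} H t^{i}$, which are permuted by $t$ under conjugation. For a finite generating set $S$ of $G$ and $n \in \mathbb{N}_0$, let $B_S(n)$ denote the ball of radius $n$ around $1$ in the Cayley graph of $G$ with respect to $S$, i.e. the set of all elements of $G$ that are products of at most $n$ elements of $S\cup S^{-1}$. Then, for every finite generating set $S$ of $G$, the base group $N$ has density zero in $G$ with respect to $S$, that is, $$\operatorname{dens}_S(N) = \limsup_{n\to\infty} \frac{|N\cap B_S(n)|}{|B_S(n)|} = 0,$$ and, in fact, the upper limit is a proper limit: $$\lim_{n\to\infty} \frac{|N\cap B_S(n)|}{|B_S(n)|} = 0.$$ -/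

import Mathlib

open Filter Topology

/-- The restricted standard wreath product `H ≀ K`: the subgroup of Mathlib's (complete) regular
wreath product `H ≀ᵣ K`, whose elements are pairs `(f, k)` with `f : K → H` and `k : K`, consisting
of the pairs for which `f` has finite support. -/
def restrictedWreathProduct (H K : Type*) [Group H] [Group K] : Subgroup (H ≀ᵣ K) where
  carrier := {g | (Function.mulSupport g.left).Finite}
  one_mem' := by simp
  mul_mem' := by
    intro a b ha hb
    refine (ha.union (hb.preimage ((mul_right_injective (a.right⁻¹)).injOn))).subset ?_
    exact Function.mulSupport_mul a.left (fun x => b.left (a.right⁻¹ * x))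
  inv_mem' := by
    intro a ha
    refine (ha.preimage ((mul_right_injective a.right).injOn)).subset ?_
    intro x hx
    simpa using hx

/-- The base group of the restricted wreath product `H ≀ K`: the elements `(f, 1)`, where
`f : K → H` has finite support. It is the direct sum of copies of `H` indexed by `K`, the copy
with index `k` being the conjugate by `k` of the copy with index `1`. -/
def baseGroup (H K : Type*) [Group H] [Group K] : Subgroup (restrictedWreathProduct H K) where
  carrier := {g | g.1.right = 1}
  one_mem' := rfl
  mul_mem' := by
    intro a b ha hb
    simp only [Set.mem_ofPred_eq] at ha hb ⊢
    simp [ha, hb]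
  inv_mem' := by
    intro a ha
    simp only [Set.mem_ofPred_eq] at ha ⊢
    simp [ha]

/-- The ball `B_S(n)` of radius `n` around `1` in the Cayley graph of `G` with respect to `S`. -/
def cayleyBall {G : Type*} [Group G] (S : Set G) (n : ℕ) : Set G :=
  {g | (SimpleGraph.mulCayley S).edist 1 g ≤ n}

/-- The ball `B_S(n)` consists of the products of at most `n` elements of `S ∪ S⁻¹`. -/
theorem mem_cayleyBall_iff {G : Type*} [Group G] {S : Set G} {n : ℕ} {g : G} :
    g ∈ cayleyBall S n ↔
      ∃ l : List G, l.length ≤ n ∧ (∀ x ∈ l, x ∈ S ∨ x⁻¹ ∈ S) ∧ l.prod = g := by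
  change (SimpleGraph.mulCayley S).edist 1 g ≤ n ↔ _
  constructor
  · intro h
    obtain ⟨p, hp⟩ := SimpleGraph.exists_walk_of_edist_ne_top
      (ne_top_of_le_ne_top (ENat.natCast_ne_top n) h)
    rw [← hp, Nat.cast_le] at h
    have key : ∀ (u v : G) (p : (SimpleGraph.mulCayley S).Walk u v), ∃ l : List G,
        l.length ≤ p.length ∧ (∀ x ∈ l, x ∈ S ∨ x⁻¹ ∈ S) ∧ u * l.prod = v := by
      intro u v p
      induction p with
      | nil => exact ⟨[], by simp⟩
      | @cons u v w hadj p ih =>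
        obtain ⟨l, h1, h2, h3⟩ := ih
        refine ⟨(u⁻¹ * v) :: l, by simpa using h1, ?_, by simp [← h3, mul_assoc]⟩
        intro x hx
        rcases List.mem_cons.1 hx with rfl | hx
        · obtain ⟨-, y, hy, rfl | rfl⟩ := (SimpleGraph.mulCayley_adj' S u v).1 hadj
          · left; simpa using hy
          · right; simpa using hy
        · exact h2 x hx
    obtain ⟨l, h1, h2, h3⟩ := key _ _ p
    exact ⟨l, h1.trans h, h2, by simpa using h3⟩
  · rintro ⟨l, hl, hmem, rfl⟩
    have key : ∀ (l : List G) (u : G), (∀ x ∈ l, x ∈ S ∨ x⁻¹ ∈ S) →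
        (SimpleGraph.mulCayley S).edist u (u * l.prod) ≤ l.length := by
      intro l
      induction l with
      | nil => intro u _; simp
      | cons x l ih =>
        intro u h
        have h1 : (SimpleGraph.mulCayley S).edist u (u * x) ≤ 1 := by
          by_cases hx : u = u * x
          · rw [← hx]; simp
          · refine le_of_eq (SimpleGraph.edist_eq_one_iff_adj.2 ?_)
            rw [SimpleGraph.mulCayley_adj']
            refine ⟨hx, ?_⟩
            rcases h x (by simp) with hS | hS
            · exact ⟨x, hS, Or.inl rfl⟩
            · exact ⟨x⁻¹, hS, Or.inr (by simp)⟩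
        have h2 := ih (u * x) (fun y hy => h y (by simp [hy]))
        rw [List.prod_cons, ← mul_assoc, List.length_cons, Nat.cast_add, Nat.cast_one, add_comm]
        exact SimpleGraph.edist_triangle.trans (add_le_add h1 h2)
    simpa using (key l 1 hmem).trans (Nat.cast_le.2 hl)

/-- Balls with respect to a finite set are finite, so that `Set.ncard` below is the true
cardinality. -/
theorem cayleyBall_finite {G : Type*} [Group G] {S : Set G} (hS : S.Finite) (n : ℕ) :
    (cayleyBall S n).Finite := by
  have hT : (S ∪ S⁻¹).Finite := hS.union hS.inv
  have : Finite ↥(S ∪ S⁻¹) := hT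
  refine ((List.finite_length_le ↥(S ∪ S⁻¹) n).image
    (fun l => (l.map Subtype.val).prod)).subset ?_
  intro g hg
  obtain ⟨l, hl, hmem, rfl⟩ := mem_cayleyBall_iff.1 hg
  refine ⟨l.attach.map (fun x => ⟨x.1, hmem x.1 x.2⟩), by simpa using hl, ?_⟩
  simp [Function.comp_def]

/-- The ratio `|X ∩ B_S(n)| / |B_S(n)|`. The denominator is positive for finite `S`, because `1`
lies in every ball. -/
noncomputable def ballRatio {G : Type*} [Group G] (S X : Set G) (n : ℕ) : ℝ :=
  ((X ∩ cayleyBall S n).ncard : ℝ) / ((cayleyBall S n).ncard : ℝ)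

/-- The density `dens_S(X) = limsup_{n → ∞} |X ∩ B_S(n)| / |B_S(n)|`. For finite `S` the ratios lie
in `[0, 1]`, so this is the usual upper limit. -/
noncomputable def density {G : Type*} [Group G] (S X : Set G) : ℝ :=
  limsup (fun n : ℕ => ballRatio S X n) atTop

/-! A word in `S ∪ S⁻¹` traces a path of heights in ℤ, which is closed for elements of the base
group. If `r` bounds the steps and lamps of the letters, only lamps within `r` of the path change.
Fix thresholds `k` and `M`. Three kinds of elements of the base group are compared with `B_S(n)`;
enlarging the radius by a constant costs only a constant factor.

Elements of `B_S(M)` are negligible, since the balls grow without bound.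

If an element has words with path in `[-k, k]`, but the shortest is longer than `M`, that word can
be cut at `M` places. A long shift inserted at the cut separates the lamps of the two pieces, so the
cut can be read off. The proportion is `O(1/M)` for fixed `k`
(`IsBound.exists_mul_ncard_narrowBall_le`).

Otherwise, up to inversion and reflection of ℤ, the element is `x * y * z` with a path down to its
minimum, up to its maximum `b > k`, and back. The stretch from `0` to `b` is crossed by both `y` and
`z`, so a pair of lamps `s` is absorbed at bounded cost into `y * s` and into `s⁻¹ * z`. In `x * τ *
(y * s)⁻¹ * τ * s⁻¹ * z` every factor descends; the shifts `τ` make their lamps disjoint, so all of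
them, and hence `s`, can be recovered. About `b²/4` choices of `s` give the proportion `O(1/b²)`
(`IsBound.exists_mul_ncard_tourBall_le`), with sum `O(1/k)` over `b > k`; a single lamp would only
give the divergent sum of `1/b`. -/

/-! ### Balls in Cayley graphs -/

section Ball

variable {G : Type*} [Group G] {S : Set G}

theorem cayleyBall_mono {m n : ℕ} (h : m ≤ n) : cayleyBall S m ⊆ cayleyBall S n := by
  intro g hg
  rw [mem_cayleyBall_iff] at hg ⊢
  obtain ⟨l, h1, h2⟩ := hg
  exact ⟨l, h1.trans h, h2⟩

theorem list_prod_mem_cayleyBall {l : List G} (hl : ∀ x ∈ l, x ∈ S ∨ x⁻¹ ∈ S) :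
    l.prod ∈ cayleyBall S l.length :=
  mem_cayleyBall_iff.2 ⟨l, le_rfl, hl, rfl⟩

theorem one_mem_cayleyBall (n : ℕ) : (1 : G) ∈ cayleyBall S n :=
  mem_cayleyBall_iff.2 ⟨[], by simp⟩

theorem mul_mem_cayleyBall {m n : ℕ} {g h : G} (hg : g ∈ cayleyBall S m)
    (hh : h ∈ cayleyBall S n) : g * h ∈ cayleyBall S (m + n) := by
  rw [mem_cayleyBall_iff] at hg hh ⊢
  obtain ⟨l, h1, h2, rfl⟩ := hg
  obtain ⟨l', h1', h2', rfl⟩ := hh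
  refine ⟨l ++ l', by simp; omega, ?_, by simp⟩
  intro x hx
  rcases List.mem_append.1 hx with hx | hx
  exacts [h2 x hx, h2' x hx]

theorem inv_mem_cayleyBall {n : ℕ} {g : G} (hg : g ∈ cayleyBall S n) :
    g⁻¹ ∈ cayleyBall S n := by
  rw [mem_cayleyBall_iff] at hg ⊢
  obtain ⟨l, h1, h2, rfl⟩ := hg
  refine ⟨(l.map (·⁻¹)).reverse, by simpa using h1, ?_, by rw [List.prod_inv_reverse]⟩
  intro x hx
  simp only [List.mem_reverse, List.mem_map] at hx
  obtain ⟨y, hy, rfl⟩ := hx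
  simpa using (h2 y hy).symm

theorem exists_mem_cayleyBall (hgen : Subgroup.closure S = ⊤) (g : G) :
    ∃ n, g ∈ cayleyBall S n := by
  have hg : g ∈ Subgroup.closure S := hgen ▸ Subgroup.mem_top g
  rw [← Subgroup.mem_toSubmonoid, Subgroup.closure_toSubmonoid] at hg
  obtain ⟨l, h1, rfl⟩ := Submonoid.exists_list_of_mem_closure hg
  exact ⟨l.length, list_prod_mem_cayleyBall fun x hx => by simpa using h1 x hx⟩

theorem exists_subset_cayleyBall (hgen : Subgroup.closure S = ⊤) {F : Set G} (hF : F.Finite) :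
    ∃ n, F ⊆ cayleyBall S n := by
  choose n hn using exists_mem_cayleyBall hgen
  refine ⟨hF.toFinset.sup n, fun g hg => cayleyBall_mono ?_ (hn g)⟩
  exact Finset.le_sup (f := n) (by simpa using hg)

/-- Words can be cut after `m` letters. This absorbs the bounded increase of radius in the
injections below into a constant factor. -/
theorem ncard_cayleyBall_add_le (hS : S.Finite) (m n : ℕ) :
    (cayleyBall S (m + n)).ncard ≤ (cayleyBall S m).ncard * (cayleyBall S n).ncard := by
  rw [← Set.ncard_prod]
  have hfin := (cayleyBall_finite hS m).prod (cayleyBall_finite hS n)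
  refine le_trans (Set.ncard_le_ncard ?_ (hfin.image fun p => p.1 * p.2))
    (Set.ncard_image_le hfin)
  intro g hg
  obtain ⟨l, h1, h2, rfl⟩ := mem_cayleyBall_iff.1 hg
  refine ⟨((l.take m).prod, (l.drop m).prod), ⟨?_, ?_⟩, by simp [← List.prod_append]⟩
  · exact mem_cayleyBall_iff.2 ⟨_, by simp, fun x hx => h2 x (List.mem_of_mem_take hx), rfl⟩
  · exact mem_cayleyBall_iff.2 ⟨_, by simp; omega, fun x hx => h2 x (List.mem_of_mem_drop hx), rfl⟩

theorem ncard_cayleyBall_pos (hS : S.Finite) (n : ℕ) : 0 < (cayleyBall S n).ncard :=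
  (Set.ncard_pos (cayleyBall_finite hS n)).2 ⟨1, one_mem_cayleyBall n⟩

theorem tendsto_ncard_cayleyBall [Infinite G] (hS : S.Finite)
    (hgen : Subgroup.closure S = ⊤) :
    Tendsto (fun n => (cayleyBall S n).ncard) atTop atTop := by
  refine tendsto_atTop.2 fun b => ?_
  obtain ⟨F, -, hF⟩ := (Set.infinite_univ (α := G)).exists_subset_card_eq b
  obtain ⟨N, hN⟩ := exists_subset_cayleyBall hgen F.finite_toSet
  filter_upwards [eventually_ge_atTop N] with n hn
  rw [← hF, ← Set.ncard_coe_finset F]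
  exact Set.ncard_le_ncard (hN.trans (cayleyBall_mono hn)) (cayleyBall_finite hS n)

end Ball

/-! ### Lamp coordinates on the wreath product -/

/-- Coordinates that identify `G` with the restricted wreath product `H ≀ ℤ`: the element `g` is
given by the finitely supported function `lamp g` and by the integer `height g`. -/
structure LampCoordinates (G H : Type*) [Group G] [Group H] where
  lamp : G → ℤ → H
  height : G → ℤ
  lamp_mul : ∀ g g' i, lamp (g * g') i = lamp g i * lamp g' (i - height g)
  height_mul : ∀ g g', height (g * g') = height g + height g'
  ext : ∀ g g', (∀ i, lamp g i = lamp g' i) → height g = height g' → g = g'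
  finite_support : ∀ g, (Function.mulSupport (lamp g)).Finite
  exists_eq : ∀ (f : ℤ → H) (d : ℤ), (Function.mulSupport f).Finite →
    ∃ g, lamp g = f ∧ height g = d

namespace LampCoordinates

variable {G H : Type*} [Group G] [Group H] (c : LampCoordinates G H)

/-- The coordinates obtained by reversing the direction of `ℤ`. -/
def neg : LampCoordinates G H where
  lamp g i := c.lamp g (-i)
  height g := -c.height g
  lamp_mul g g' i := by rw [c.lamp_mul]; congr 2; ring
  height_mul g g' := by rw [c.height_mul]; ring
  ext g g' h1 h2 := c.ext g g' (fun i => by simpa using h1 (-i)) (neg_injective h2)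
  finite_support g := (c.finite_support g).preimage (f := fun i : ℤ => -i) neg_injective.injOn
  exists_eq f d hf := by
    obtain ⟨g, h1, h2⟩ := c.exists_eq (fun i => f (-i)) (-d)
      (hf.preimage (f := fun i : ℤ => -i) neg_injective.injOn)
    exact ⟨g, by simp [h1], by simp [h2]⟩

@[simp] theorem height_neg (g : G) : c.neg.height g = -c.height g := rfl

@[simp] theorem lamp_neg (g : G) (i : ℤ) : c.neg.lamp g i = c.lamp g (-i) := rfl

@[simp] theorem height_one : c.height 1 = 0 := by
  have := c.height_mul 1 1
  rw [mul_one] at this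
  omega

@[simp] theorem lamp_one (i : ℤ) : c.lamp 1 i = 1 := by
  have := c.lamp_mul 1 1 i
  rw [mul_one, height_one, sub_zero] at this
  exact left_eq_mul.1 this

@[simp] theorem height_inv (g : G) : c.height g⁻¹ = -c.height g := by
  have := c.height_mul g g⁻¹
  rw [mul_inv_cancel, height_one] at this
  omega

theorem lamp_inv (g : G) (i : ℤ) : c.lamp g⁻¹ i = (c.lamp g (i + c.height g))⁻¹ := by
  have := c.lamp_mul g⁻¹ g i
  rw [inv_mul_cancel, lamp_one, height_inv, sub_neg_eq_add] at this
  exact eq_inv_of_mul_eq_one_left this.symm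

/-- The element with trivial lamps and height `d`. -/
noncomputable def shift (d : ℤ) : G :=
  (c.exists_eq 1 d (by simp)).choose

@[simp] theorem lamp_shift (d i : ℤ) : c.lamp (c.shift d) i = 1 :=
  congrFun (c.exists_eq 1 d (by simp)).choose_spec.1 i

@[simp] theorem height_shift (d : ℤ) : c.height (c.shift d) = d :=
  (c.exists_eq 1 d (by simp)).choose_spec.2

theorem mulSupport_mulSingle_finite (i : ℤ) (h : H) :
    (Function.mulSupport (Pi.mulSingle i h : ℤ → H)).Finite :=
  (Set.finite_singleton i).subset Pi.mulSupport_mulSingle_subset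

/-- The element of height `0` whose only lamp is `h`, at position `i`. -/
noncomputable def single (i : ℤ) (h : H) : G :=
  (c.exists_eq (Pi.mulSingle i h) 0 (mulSupport_mulSingle_finite i h)).choose

theorem lamp_single (i : ℤ) (h : H) (j : ℤ) :
    c.lamp (c.single i h) j = if j = i then h else 1 := by
  rw [single, (c.exists_eq _ 0 (mulSupport_mulSingle_finite i h)).choose_spec.1,
    Pi.mulSingle_apply]

@[simp] theorem height_single (i : ℤ) (h : H) : c.height (c.single i h) = 0 :=
  (c.exists_eq _ 0 (mulSupport_mulSingle_finite i h)).choose_spec.2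

theorem infinite (c : LampCoordinates G H) : Infinite G :=
  Infinite.of_injective c.shift fun d e h => by
    rw [← c.height_shift d, ← c.height_shift e, h]

/-- A product `u * v` in which all lamps of `u` lie to the right of a gap and all lamps of `v` to
its left determines its factors. -/
theorem eq_and_eq_of_mul_eq_mul {u u' v v' : G} {r : ℤ} (hh : c.height u = c.height u')
    (hu : ∀ j < c.height u - r, c.lamp u j = 1) (hu' : ∀ j < c.height u' - r, c.lamp u' j = 1)
    (hv : ∀ j, -r ≤ j → c.lamp v j = 1) (hv' : ∀ j, -r ≤ j → c.lamp v' j = 1)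
    (h : u * v = u' * v') : u = u' ∧ v = v' := by
  have huu : u = u' := by
    refine c.ext _ _ (fun i => ?_) hh
    rcases lt_or_ge i (c.height u - r) with hi | hi
    · rw [hu i hi, hu' i (hh ▸ hi)]
    · have := congrArg (fun g => c.lamp g i) h
      simp only [c.lamp_mul] at this
      rwa [hv _ (by omega), hv' _ (by omega), mul_one, mul_one] at this
  subst huu
  exact ⟨rfl, mul_left_cancel h⟩

/-! ### Words, their paths and the lamps they reach -/

/-- `r` bounds the steps and the lamps of the elements of `S` and their inverses. -/
def IsBound (S : Set G) (r : ℤ) : Prop :=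
  ∀ x, x ∈ S ∨ x⁻¹ ∈ S → |c.height x| ≤ r ∧ ∀ j, r < |j| → c.lamp x j = 1

theorem exists_isBound {S : Set G} (hS : S.Finite) : ∃ r, 0 ≤ r ∧ c.IsBound S r := by
  have hT : (S ∪ S⁻¹).Finite := hS.union hS.inv
  have h1 : ∀ x, ∃ r : ℤ, |c.height x| ≤ r ∧ ∀ j, r < |j| → c.lamp x j = 1 := by
    intro x
    obtain ⟨b, hb⟩ := ((c.finite_support x).image (fun j => |j|)).bddAbove
    refine ⟨max b |c.height x|, le_max_right _ _, fun j hj => ?_⟩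
    by_contra hne
    exact absurd (hb ⟨j, hne, rfl⟩) (not_le.2 ((le_max_left _ _).trans_lt hj))
  choose r hr using h1
  obtain ⟨b, hb⟩ := (hT.image r).bddAbove
  refine ⟨max b 0, le_max_right _ _, fun x hx => ?_⟩
  have hxb : r x ≤ max b 0 := (hb ⟨x, by simpa using hx, rfl⟩).trans (le_max_left _ _)
  exact ⟨(hr x).1.trans hxb, fun j hj => (hr x).2 j (hxb.trans_lt hj)⟩

theorem IsBound.neg {S : Set G} {r : ℤ} (h : c.IsBound S r) : c.neg.IsBound S r := by
  intro x hx
  refine ⟨by simpa using (h x hx).1, fun j hj => (h x hx).2 _ (by simpa using hj)⟩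

variable {c} {S : Set G} {r : ℤ}

/-- A word does not change the lamps at positions that are far from all points of its path. -/
theorem IsBound.lamp_prod_eq_one (hr : c.IsBound S r) {l : List G}
    (hl : ∀ x ∈ l, x ∈ S ∨ x⁻¹ ∈ S) {j : ℤ}
    (hj : ∀ p, p <+: l → r < |j - c.height p.prod|) : c.lamp l.prod j = 1 := by
  induction l using List.reverseRecOn with
  | nil => simp
  | append_singleton l x ih =>
    rw [List.prod_append, c.lamp_mul, ih (fun y hy => hl y (by simp [hy]))
      (fun p hp => hj p (hp.trans (List.prefix_append _ _))), one_mul, List.prod_singleton]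
    exact (hr x (hl x (by simp))).2 _ (hj l (List.prefix_append _ _))

theorem IsBound.abs_height_prod_le (hr : c.IsBound S r) {l : List G}
    (hl : ∀ x ∈ l, x ∈ S ∨ x⁻¹ ∈ S) : |c.height l.prod| ≤ l.length * r := by
  induction l with
  | nil => simp
  | cons x l ih =>
    have h1 := ih fun y hy => hl y (by simp [hy])
    have h2 := (hr x (hl x (by simp))).1
    rw [List.prod_cons, c.height_mul, List.length_cons]
    push_cast
    have := abs_add_le (c.height x) (c.height l.prod)
    linarith

/-- A word whose path leads from `0` to a point to the right of `p ≥ 0` splits at a point close to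
`p` after which the lamp at `p` is not changed. -/
theorem IsBound.exists_split (hr : c.IsBound S r) (hr0 : 0 ≤ r) {p : ℤ} (hp : 0 ≤ p) {l : List G}
    (hl : ∀ x ∈ l, x ∈ S ∨ x⁻¹ ∈ S) (hpl : p ≤ c.height l.prod) :
    ∃ l₁ l₂, l = l₁ ++ l₂ ∧ p ≤ c.height l₁.prod ∧ c.height l₁.prod ≤ p + 2 * r ∧
      c.lamp l₂.prod (p - c.height l₁.prod) = 1 := by
  induction l using List.reverseRecOn with
  | nil => exact ⟨[], [], rfl, hpl, by simp; omega, by simp⟩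
  | append_singleton l x ih =>
    rcases le_or_gt (c.height (l ++ [x]).prod) (p + 2 * r) with h | h
    · exact ⟨l ++ [x], [], by simp, hpl, h, by simp⟩
    · obtain ⟨hx1, hx2⟩ := hr x (hl x (by simp))
      rw [List.prod_append, List.prod_singleton, c.height_mul] at h
      have hx := (abs_le.1 hx1).2
      -- The last letter starts beyond `p + r`, hence out of reach of the lamp at `p`, and can be
      -- moved into `l₂`.
      obtain ⟨l₁, l₂, rfl, h1, h2, h3⟩ := ih (fun y hy => hl y (by simp [hy])) (by omega)
      refine ⟨l₁, l₂ ++ [x], by simp, h1, h2, ?_⟩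
      rw [List.prod_append, c.lamp_mul, h3, one_mul, List.prod_singleton]
      rw [List.prod_append, c.height_mul] at h
      exact hx2 _ (lt_abs.2 (Or.inr (by omega)))

/-- Switching on a lamp between the start and the end of a path costs only boundedly many
letters. -/
theorem IsBound.exists_mul_single_mem (hr : c.IsBound S r) (hr0 : 0 ≤ r)
    (hgen : Subgroup.closure S = ⊤) (h : H) :
    ∃ C, ∀ (n : ℕ) (g : G), g ∈ cayleyBall S n → ∀ i, 0 ≤ i → i ≤ c.height g →
      g * c.single (-i) h ∈ cayleyBall S (n + C) := by
  -- Seen from the split point, the lamp lies in `[-2r, 0]`, so finitely many elements suffice for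
  -- all `g` and `i`.
  obtain ⟨C, hC⟩ := exists_subset_cayleyBall hgen
    ((Set.finite_Icc (-(2 * r)) 0).image fun k => c.single k h)
  refine ⟨C, fun n g hg i hi0 hi => ?_⟩
  obtain ⟨l, h1, h2, rfl⟩ := mem_cayleyBall_iff.1 hg
  obtain ⟨l₁, l₂, rfl, h3, h4, h5⟩ :=
    hr.exists_split hr0 (p := c.height l.prod - i) (by omega) h2 (by omega)
  set q := c.height (l₁ ++ l₂).prod - i - c.height l₁.prod with hq
  have hht : c.height (l₁ ++ l₂).prod = c.height l₁.prod + c.height l₂.prod := by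
    rw [List.prod_append, c.height_mul]
  -- As `H` may be nonabelian, this needs `h5`: the second half leaves the lamp at `q` alone.
  have hcomm : l₂.prod * c.single (-i) h = c.single q h * l₂.prod := by
    refine c.ext _ _ (fun j => ?_) (by simp [c.height_mul])
    rw [c.lamp_mul, c.lamp_mul, lamp_single, lamp_single, height_single, sub_zero]
    by_cases hj : j = q
    · rw [if_pos (by omega), if_pos hj, hj, h5, one_mul, mul_one]
    · rw [if_neg (by omega), if_neg hj, one_mul, mul_one]
  have hmem : c.single q h ∈ cayleyBall S C := hC ⟨q, ⟨by omega, by omega⟩, rfl⟩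
  rw [List.prod_append, mul_assoc, hcomm]
  have := mul_mem_cayleyBall
    (list_prod_mem_cayleyBall (l := l₁) fun x hx => h2 x (by simp [hx]))
    (mul_mem_cayleyBall hmem (list_prod_mem_cayleyBall (l := l₂) fun x hx => h2 x (by simp [hx])))
  refine cayleyBall_mono ?_ this
  rw [List.length_append] at h1
  omega

/-! ### Narrow paths -/

/-- `l` is a word of length at most `n` for `g` whose path stays in `[-k, k]`. -/
structure IsNarrowWord (c : LampCoordinates G H) (S : Set G) (k : ℤ) (n : ℕ) (g : G)
    (l : List G) : Prop where
  length_le : l.length ≤ n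
  letters : ∀ x ∈ l, x ∈ S ∨ x⁻¹ ∈ S
  prod_eq : l.prod = g
  narrow : ∀ p, p <+: l → |c.height p.prod| ≤ k

/-- The elements of the ball of radius `n` that are reached by a path that stays in `[-k, k]`. -/
def narrowBall (c : LampCoordinates G H) (S : Set G) (k : ℤ) (n : ℕ) : Set G :=
  {g | ∃ l, c.IsNarrowWord S k n g l}

theorem narrowBall_subset (k : ℤ) (n : ℕ) : c.narrowBall S k n ⊆ cayleyBall S n :=
  fun _ ⟨l, hl⟩ => mem_cayleyBall_iff.2 ⟨l, hl.length_le, hl.letters, hl.prod_eq⟩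

/-- The prefixes of a shortest narrow word have distinct values. -/
theorem IsNarrowWord.take_prod_injOn {k : ℤ} {n : ℕ} {g : G} {l : List G}
    (hl : c.IsNarrowWord S k n g l)
    (hmin : ∀ m l', c.IsNarrowWord S k m g l' → l.length ≤ l'.length) {i j : ℕ}
    (hij : i < j) (hj : j ≤ l.length) : (l.take i).prod ≠ (l.take j).prod := by
  intro heq
  have hsub : ∀ x ∈ l.take i ++ l.drop j, x ∈ l := fun x hx =>
    (List.mem_append.1 hx).elim List.mem_of_mem_take List.mem_of_mem_drop
  -- Excising the loop between the two equal prefixes keeps the heights of all remaining prefixes,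
  -- so the shorter word is still narrow.
  have := hmin _ (l.take i ++ l.drop j) ⟨le_rfl, fun x hx => hl.letters x (hsub x hx), by
    rw [List.prod_append, heq, ← List.prod_append, List.take_append_drop, hl.prod_eq], ?_⟩
  · simp at this
    omega
  intro p hp
  rcases List.prefix_or_prefix_of_prefix hp (List.prefix_append _ _) with hp' | ⟨q, rfl⟩
  · exact hl.narrow p (hp'.trans (List.take_prefix _ _))
  · rw [List.prod_append, heq, ← List.prod_append]
    refine hl.narrow _ ?_
    conv_rhs => rw [← List.take_append_drop j l]
    exact (List.prefix_append_right_inj _).2 ((List.prefix_append_right_inj _).1 hp)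

/-- Narrow elements are rare: a long narrow word can be cut at many places, and the cut remains
visible when a long shift is inserted there. -/
theorem IsBound.exists_mul_ncard_narrowBall_le (hr : c.IsBound S r) (hS : S.Finite)
    (hgen : Subgroup.closure S = ⊤) (k : ℕ) :
    ∃ C, ∀ M n : ℕ, M * (c.narrowBall S k n \ c.narrowBall S k M).ncard ≤
      (2 * k + 1) * (cayleyBall S (n + C)).ncard := by
  classical
  -- Seen from the cut, the first piece has lamps only at or above `-(2k + r)` and the second only
  -- at or below `2k + r`; this shift takes the latter strictly below the former.
  set τ := c.shift (-(4 * k + 2 * r + 1)) with hτ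
  obtain ⟨C, hC⟩ := exists_mem_cayleyBall hgen τ
  refine ⟨C, fun M n => ?_⟩
  have hex : ∀ g, g ∈ c.narrowBall S k n \ c.narrowBall S k M → ∃ l,
      c.IsNarrowWord S k n g l ∧ (∀ m l', c.IsNarrowWord S k m g l' → l.length ≤ l'.length) ∧
        M < l.length := by
    rintro g ⟨⟨l₀, hl₀⟩, hgM⟩
    have hne : ∃ m, ∃ l, c.IsNarrowWord S k m g l := ⟨n, l₀, hl₀⟩
    obtain ⟨l, hl⟩ := Nat.find_spec hne
    have hlen : ∀ m l', c.IsNarrowWord S k m g l' → Nat.find hne ≤ l'.length :=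
      fun m l' hl' => Nat.find_min' hne ⟨l', le_rfl, hl'.letters, hl'.prod_eq, hl'.narrow⟩
    refine ⟨l, ⟨hl.length_le.trans ((hlen _ _ hl₀).trans hl₀.length_le), hl.letters, hl.prod_eq,
      hl.narrow⟩, fun m l' hl' => hl.length_le.trans (hlen m l' hl'), ?_⟩
    by_contra hle
    exact hgM ⟨l, not_lt.1 hle, hl.letters, hl.prod_eq, hl.narrow⟩
  choose! w hw hmin hM using hex
  have hcard : (Set.Icc (-(k : ℤ)) k).ncard = 2 * k + 1 := by
    rw [Set.ncard_eq_toFinset_card', Set.toFinset_Icc, Int.card_Icc]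
    omega
  have hMcard : (Set.Iio M).ncard = M := by
    rw [Set.ncard_eq_toFinset_card', Set.toFinset_Iio, Nat.card_Iio]
  rw [← hcard, ← Set.ncard_prod]
  nth_rw 1 [← hMcard]
  rw [← Set.ncard_prod]
  -- The height at the cut is recorded as well, since it is needed to locate the gap; this costs the
  -- factor `2k + 1`.
  refine Set.ncard_le_ncard_of_injOn
    (fun p => (c.height ((w p.2).take p.1).prod,
      ((w p.2).take p.1).prod * (τ * ((w p.2).drop p.1).prod))) ?_ ?_
    ((Set.finite_Icc _ _).prod (cayleyBall_finite hS _))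
  · rintro ⟨i, g⟩ ⟨-, hg⟩
    have hwg := hw g hg
    refine ⟨abs_le.1 (hwg.narrow _ (List.take_prefix _ _)), ?_⟩
    have := mul_mem_cayleyBall
      (list_prod_mem_cayleyBall (l := (w g).take i)
        fun x hx => hwg.letters x (List.mem_of_mem_take hx))
      (mul_mem_cayleyBall hC (list_prod_mem_cayleyBall (l := (w g).drop i)
        fun x hx => hwg.letters x (List.mem_of_mem_drop hx)))
    refine cayleyBall_mono ?_ this
    have := hwg.length_le
    simp only [List.length_take, List.length_drop]
    omega
  · have hu : ∀ i g, g ∈ c.narrowBall S k n \ c.narrowBall S k M →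
        ∀ j < c.height ((w g).take i).prod - (2 * k + r),
          c.lamp ((w g).take i).prod j = 1 := by
      intro i g hg j hj
      refine hr.lamp_prod_eq_one
        (fun x hx => (hw g hg).letters x (List.mem_of_mem_take hx)) fun p hp => ?_
      have h1 := abs_le.1 ((hw g hg).narrow _ (hp.trans (List.take_prefix _ _)))
      have h2 := abs_le.1 ((hw g hg).narrow _ (List.take_prefix i _))
      exact lt_abs.2 (Or.inr (by omega))
    have hv : ∀ i g, g ∈ c.narrowBall S k n \ c.narrowBall S k M →
        ∀ j, -(2 * k + r) ≤ j → c.lamp (τ * ((w g).drop i).prod) j = 1 := by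
      intro i g hg j hj
      rw [c.lamp_mul, hτ, lamp_shift, one_mul, height_shift]
      refine hr.lamp_prod_eq_one
        (fun x hx => (hw g hg).letters x (List.mem_of_mem_drop hx)) fun p hp => ?_
      have h1 := abs_le.1 ((hw g hg).narrow ((w g).take i ++ p) (by
        conv_rhs => rw [← List.take_append_drop i (w g)]
        exact (List.prefix_append_right_inj _).2 hp))
      have h2 := abs_le.1 ((hw g hg).narrow _ (List.take_prefix i _))
      rw [List.prod_append, c.height_mul] at h1
      exact lt_abs.2 (Or.inl (by omega))
    rintro ⟨i, g⟩ ⟨hi, hg⟩ ⟨i', g'⟩ ⟨hi', hg'⟩ h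
    simp only [Prod.mk.injEq, Set.mem_Iio] at h hi hi' hg hg' ⊢
    obtain ⟨h1, h2⟩ := c.eq_and_eq_of_mul_eq_mul h.1 (hu i g hg) (hu i' g' hg') (hv i g hg)
      (hv i' g' hg') h.2
    have hgg : g = g' := by
      rw [← (hw g hg).prod_eq, ← (hw g' hg').prod_eq, ← List.take_append_drop i (w g),
        ← List.take_append_drop i' (w g'), List.prod_append, List.prod_append, h1,
        mul_left_cancel h2]
    subst hgg
    -- The word depends only on `g`, and its prefixes have distinct products, so the first piece
    -- determines the cut.
    refine ⟨?_, rfl⟩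
    have hlt := hM g hg
    rcases lt_trichotomy i i' with hii | hii | hii
    · exact absurd h1 ((hw g hg).take_prod_injOn (hmin g hg) hii (by omega))
    · exact hii
    · exact absurd h1.symm ((hw g hg).take_prod_injOn (hmin g hg) hii (by omega))

/-! ### Tours with a large maximum -/

/-- The elements of the base group with a factorization `x * y * z` of length at most `n` that
descends to a minimum `-a`, climbs to the maximum `b`, and returns. -/
def tourBall (c : LampCoordinates G H) (S : Set G) (r : ℤ) (b n : ℕ) : Set G :=
  {g | ∃ (x y z : G) (l₁ l₂ l₃ : ℕ) (a : ℤ), g = x * y * z ∧ l₁ + l₂ + l₃ ≤ n ∧ 0 ≤ a ∧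
    x ∈ cayleyBall S l₁ ∧ y ∈ cayleyBall S l₂ ∧ z ∈ cayleyBall S l₃ ∧
    c.height x = -a ∧ c.height y = a + b ∧ c.height z = -b ∧
    (∀ j < -a - r, c.lamp x j = 1) ∧ (∀ j < -r, c.lamp y j = 1) ∧
    (∀ j > a + b + r, c.lamp y j = 1) ∧ ∀ j > r, c.lamp z j = 1}

/-- The element with two lamps `h`, at the positions `-2i` and `-(2i'+1)`. -/
noncomputable def lampPair (c : LampCoordinates G H) (h : H) (i i' : ℕ) : G :=
  c.single (-(2 * i : ℤ)) h * c.single (-(2 * i' + 1 : ℤ)) h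

theorem height_lampPair (h : H) (i i' : ℕ) : c.height (c.lampPair h i i') = 0 := by
  simp [lampPair, c.height_mul]

theorem lamp_lampPair (h : H) (i i' : ℕ) (j : ℤ) : c.lamp (c.lampPair h i i') j =
    (if j = -(2 * i : ℤ) then h else 1) * if j = -(2 * i' + 1 : ℤ) then h else 1 := by
  simp [lampPair, c.lamp_mul, lamp_single]

theorem lamp_lampPair_of_lt {h : H} {b i i' : ℕ} (hi : i < b / 2) (hi' : i' < b / 2) {j : ℤ}
    (hj : j ≤ -b ∨ 0 < j) : c.lamp (c.lampPair h i i') j = 1 := by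
  rw [lamp_lampPair, if_neg (by omega), if_neg (by omega), one_mul]

theorem lampPair_injective {h : H} (hh : h ≠ 1) {i i' k k' : ℕ}
    (heq : c.lampPair h i i' = c.lampPair h k k') : i = k ∧ i' = k' := by
  have key : ∀ j, c.lamp (c.lampPair h i i') j = c.lamp (c.lampPair h k k') j := by simp [heq]
  simp only [lamp_lampPair] at key
  constructor
  · have := key (-(2 * i : ℤ))
    rw [if_pos rfl, if_neg (by omega), mul_one, if_neg (c := _ = -(2 * (k' : ℤ) + 1)) (by omega),
      mul_one] at this
    by_contra hne
    rw [if_neg (by omega)] at this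
    exact hh this
  · have := key (-(2 * i' + 1 : ℤ))
    rw [if_neg (by omega), if_pos rfl, one_mul, if_neg (c := _ = -(2 * (k : ℤ))) (by omega),
      one_mul] at this
    by_contra hne
    rw [if_neg (by omega)] at this
    exact hh this

/-- Tours with large maximum are rare: the lamps between the start and the maximum can be switched
either on the way up or on the way down, and reversing the middle part of a factorization
`x * y * z` separates the three factors. -/
theorem IsBound.exists_mul_ncard_tourBall_le (hr : c.IsBound S r) (hr0 : 0 ≤ r) (hS : S.Finite)
    (hgen : Subgroup.closure S = ⊤) {h : H} (hh : h ≠ 1) :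
    ∃ C, ∀ b n : ℕ, (b / 2) ^ 2 * (c.tourBall S r b n).ncard ≤
      (cayleyBall S (n + C)).ncard := by
  obtain ⟨C₁, hC₁⟩ := hr.exists_mul_single_mem hr0 hgen h
  set τ := c.shift (-(2 * r + 1)) with hτ
  obtain ⟨C₂, hC₂⟩ := exists_mem_cayleyBall hgen τ
  -- Two lamps in each of two factors, and two copies of `τ`.
  refine ⟨4 * C₁ + 2 * C₂, fun b n => ?_⟩
  have hpair : ∀ {m : ℕ} {g : G} {i i' : ℕ}, g ∈ cayleyBall S m → b ≤ c.height g → i < b / 2 →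
      i' < b / 2 → g * c.lampPair h i i' ∈ cayleyBall S (m + 2 * C₁) := by
    intro m g i i' hg hb hi hi'
    rw [lampPair, ← mul_assoc, two_mul, ← add_assoc]
    refine hC₁ _ _ (hC₁ _ _ hg _ (by omega) (by omega)) _ (by omega) ?_
    simp only [c.height_mul, height_single]
    omega
  choose! x y z l₁ l₂ l₃ a hg hl ha hx hy hz hxa hyL hzb hxl hyl hyu hzu using
    fun (g : G) (hg : g ∈ c.tourBall S r b n) => hg
  have hcard : (Set.Iio (b / 2)).ncard = b / 2 := by
    rw [Set.ncard_eq_toFinset_card', Set.toFinset_Iio, Nat.card_Iio]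
  nth_rw 1 [← hcard]
  rw [sq, ← Set.ncard_prod, ← Set.ncard_prod]
  refine Set.ncard_le_ncard_of_injOn (fun p =>
    x p.2 * (τ * ((y p.2 * c.lampPair h p.1.1 p.1.2)⁻¹ *
      (τ * ((c.lampPair h p.1.1 p.1.2)⁻¹ * z p.2))))) ?_ ?_ (cayleyBall_finite hS _)
  · rintro ⟨⟨i, i'⟩, g⟩ ⟨⟨hi, hi'⟩, hgm⟩
    -- It is `z⁻¹` that climbs by `b`, so the lamps are added to `z⁻¹` and the result is inverted.
    have hz' := inv_mem_cayleyBall (hpair (i := i) (i' := i') (inv_mem_cayleyBall (hz g hgm))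
      (by rw [height_inv, hzb g hgm]; omega) hi hi')
    rw [mul_inv_rev, inv_inv] at hz'
    have hy' := inv_mem_cayleyBall (hpair (i := i) (i' := i') (hy g hgm)
      (by have := ha g hgm; rw [hyL g hgm]; omega) hi hi')
    refine cayleyBall_mono ?_ (mul_mem_cayleyBall (hx g hgm)
      (mul_mem_cayleyBall hC₂ (mul_mem_cayleyBall hy' (mul_mem_cayleyBall hC₂ hz'))))
    have := hl g hgm
    omega
  · rintro ⟨⟨i, i'⟩, g⟩ ⟨⟨hi, hi'⟩, hgm⟩ ⟨⟨k, k'⟩, g'⟩ ⟨⟨hk, hk'⟩, hgm'⟩ heq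
    simp only [Set.mem_Iio] at hi hi' hk hk' hgm hgm' heq
    -- The image has height `-2a - 2b - 2(2r + 1)`, and `b` is fixed.
    have haa : a g = a g' := by
      have := congrArg c.height heq
      simp only [c.height_mul, height_inv, height_lampPair, hτ, height_shift, hxa g hgm,
        hxa g' hgm', hyL g hgm, hyL g' hgm', hzb g hgm, hzb g' hgm'] at this
      omega
    have hwh : ∀ g ∈ c.tourBall S r b n, ∀ i i' : ℕ,
        c.height (y g * c.lampPair h i i')⁻¹ = -(a g + b) := by
      intro g hgm i i'
      rw [height_inv, c.height_mul, height_lampPair, hyL g hgm, add_zero]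
    have hwl : ∀ g ∈ c.tourBall S r b n, ∀ i i' : ℕ, i < b / 2 → i' < b / 2 → ∀ j,
        (j < -(a g + b) - r ∨ r < j) → c.lamp (y g * c.lampPair h i i')⁻¹ j = 1 := by
      intro g hgm i i' hi hi' j hj
      have h0 := ha g hgm
      have hyt := hyL g hgm
      rw [lamp_inv, inv_eq_one, c.height_mul, height_lampPair, c.lamp_mul,
        lamp_lampPair_of_lt hi hi' (by omega), mul_one]
      rcases hj with hj | hj
      · exact hyl g hgm _ (by omega)
      · exact hyu g hgm _ (by omega)
    have hzl : ∀ g ∈ c.tourBall S r b n, ∀ i i' : ℕ, i < b / 2 → i' < b / 2 → ∀ j, -r ≤ j →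
        c.lamp (τ * ((c.lampPair h i i')⁻¹ * z g)) j = 1 := by
      intro g hgm i i' hi hi' j hj
      rw [c.lamp_mul, hτ, lamp_shift, one_mul, height_shift, c.lamp_mul, lamp_inv, height_inv,
        height_lampPair, lamp_lampPair_of_lt hi hi' (by omega), inv_one, one_mul]
      exact hzu g hgm _ (by omega)
    have hvl : ∀ g ∈ c.tourBall S r b n, ∀ i i' : ℕ, i < b / 2 → i' < b / 2 → ∀ j, -r ≤ j →
        c.lamp (τ * ((y g * c.lampPair h i i')⁻¹ *
          (τ * ((c.lampPair h i i')⁻¹ * z g)))) j = 1 := by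
      intro g hgm i i' hi hi' j hj
      have h0 := ha g hgm
      rw [c.lamp_mul, c.lamp_mul (y g * _)⁻¹, hτ, lamp_shift, one_mul, height_shift,
        hwl g hgm i i' hi hi' _ (by omega), one_mul, hwh g hgm]
      exact hzl g hgm i i' hi hi' _ (by omega)
    obtain ⟨hxx, h1⟩ := c.eq_and_eq_of_mul_eq_mul (r := r)
      (by rw [hxa g hgm, hxa g' hgm', haa]) (by rw [hxa g hgm]; exact hxl g hgm)
      (by rw [hxa g' hgm']; exact hxl g' hgm') (hvl g hgm i i' hi hi')
      (hvl g' hgm' k k' hk hk') heq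
    obtain ⟨hyy, h2⟩ := c.eq_and_eq_of_mul_eq_mul (r := r)
      (by rw [hwh g hgm, hwh g' hgm', haa])
      (by rw [hwh g hgm]; exact fun j hj => hwl g hgm i i' hi hi' j (Or.inl hj))
      (by rw [hwh g' hgm']; exact fun j hj => hwl g' hgm' k k' hk hk' j (Or.inl hj))
      (hzl g hgm i i' hi hi') (hzl g' hgm' k k' hk hk') (mul_left_cancel h1)
    have hyy := inv_injective hyy
    have hgg : g = g' := by
      have hzz := mul_left_cancel h2
      calc g = x g * (y g * c.lampPair h i i') * ((c.lampPair h i i')⁻¹ * z g) := by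
            nth_rw 1 [hg g hgm]; group
        _ = x g' * (y g' * c.lampPair h k k') * ((c.lampPair h k k')⁻¹ * z g') := by
            rw [hxx, hyy, hzz]
        _ = g' := by
            conv_rhs => rw [hg g' hgm']
            group
    subst hgg
    obtain ⟨rfl, rfl⟩ := lampPair_injective hh (mul_left_cancel hyy)
    rfl

/-- Seen from the start of `v`, the interval `[A, B]` containing the whole path is translated by the
height of `u`. -/
theorem IsBound.lamp_factor_eq_one (hr : c.IsBound S r) {u v w : List G}
    (hl : ∀ x ∈ u ++ v ++ w, x ∈ S ∨ x⁻¹ ∈ S) {A B : ℤ}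
    (hAB : ∀ p, p <+: u ++ v ++ w → A ≤ c.height p.prod ∧ c.height p.prod ≤ B) {j : ℤ}
    (hj : j < A - c.height u.prod - r ∨ B - c.height u.prod + r < j) : c.lamp v.prod j = 1 := by
  refine hr.lamp_prod_eq_one (fun x hx => hl x (by simp [hx])) fun p hp => ?_
  have h := hAB (u ++ p)
    (((List.prefix_append_right_inj u).2 hp).trans (List.prefix_append _ _))
  rw [List.prod_append, c.height_mul] at h
  rw [lt_abs]
  omega

/-- A closed path whose maximum exceeds `k` is a tour, up to inversion. -/
theorem IsBound.exists_mem_tourBall (hr : c.IsBound S r) {l : List G}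
    (hl : ∀ x ∈ l, x ∈ S ∨ x⁻¹ ∈ S) (h0 : c.height l.prod = 0) {k : ℕ}
    (hk : ∃ p, p <+: l ∧ k < c.height p.prod) :
    ∃ b ∈ Finset.Ioc k (l.length * r.toNat), l.prod ∈ c.tourBall S r b l.length ∨
      l.prod⁻¹ ∈ c.tourBall S r b l.length := by
  obtain ⟨i, hi, hmax⟩ := Finset.exists_max_image (Finset.range (l.length + 1))
    (fun i => c.height (l.take i).prod) ⟨0, by simp⟩
  obtain ⟨j, hj, hmin⟩ := Finset.exists_min_image (Finset.range (l.length + 1))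
    (fun i => c.height (l.take i).prod) ⟨0, by simp⟩
  have hAB : ∀ p, p <+: l → c.height (l.take j).prod ≤ c.height p.prod ∧
      c.height p.prod ≤ c.height (l.take i).prod := by
    intro p hp
    have hm : p.length ∈ Finset.range (l.length + 1) := by
      have := hp.length_le
      simp only [Finset.mem_range]
      omega
    rw [List.prefix_iff_eq_take.1 hp]
    exact ⟨hmin _ hm, hmax _ hm⟩
  obtain ⟨p, hp, hkp⟩ := hk
  have hkb := hkp.trans_le (hAB p hp).2
  have ha := (hAB [] List.nil_prefix).1
  rw [List.prod_nil, height_one] at ha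
  have hbound : c.height (l.take i).prod ≤ l.length * r := by
    have h1 := (abs_le.1 (hr.abs_height_prod_le (l := l.take i)
      fun x hx => hl x (List.mem_of_mem_take hx))).2
    have h2 : ((l.take i).length : ℤ) ≤ l.length := by simp
    have hr0 : 0 ≤ r := by
      by_contra hneg
      have : ((l.take i).length : ℤ) * r ≤ 0 :=
        mul_nonpos_of_nonneg_of_nonpos (by positivity) (by omega)
      omega
    exact h1.trans (by gcongr)
  obtain ⟨b, hb⟩ := Int.eq_ofNat_of_zero_le (a := c.height (l.take i).prod) (by omega)
  refine ⟨b, ?_, ?_⟩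
  · rw [Finset.mem_Ioc]
    refine ⟨by omega, ?_⟩
    zify
    rw [← hb]
    exact hbound.trans (by gcongr; exact Int.self_le_toNat r)
  -- If the minimum comes first, the path is a tour. Otherwise the inverse word runs through the
  -- same closed path backwards and meets the minimum first.
  rcases le_total j i with hji | hij
  · left
    obtain ⟨v, hv⟩ := (List.take_prefix_take_left (l := l) hji)
    set u := l.take j with hu
    set w := l.drop i with hw
    have hluvw : l = u ++ v ++ w := by rw [hv, hw, List.take_append_drop]
    rw [← hv, List.prod_append, c.height_mul] at hb
    rw [← hv] at hAB
    clear_value u w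
    subst hluvw
    simp only [List.prod_append, c.height_mul] at h0 hAB
    refine ⟨u.prod, v.prod, w.prod, _, _, _, -c.height u.prod,
      by simp [mul_assoc], by simp [add_assoc], by omega, list_prod_mem_cayleyBall fun x hx => hl x (by simp [hx]),
      list_prod_mem_cayleyBall fun x hx => hl x (by simp [hx]),
      list_prod_mem_cayleyBall fun x hx => hl x (by simp [hx]), by omega, by omega, by omega,
      fun j hj => ?_, fun j hj => ?_, fun j hj => ?_, fun j hj => ?_⟩
    · exact hr.lamp_factor_eq_one (u := []) (v := u) (w := v ++ w) (by simpa using hl)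
        (by simpa using hAB) (by simp; omega)
    · exact hr.lamp_factor_eq_one hl hAB (by omega)
    · exact hr.lamp_factor_eq_one hl hAB (by omega)
    · exact hr.lamp_factor_eq_one (u := u ++ v) (v := w) (w := []) (by simpa using hl)
        (by simpa using hAB) (by simp only [List.prod_append, c.height_mul]; omega)
  · right
    obtain ⟨v, hv⟩ := (List.take_prefix_take_left (l := l) hij)
    set u := l.take i with hu
    set w := l.drop j with hw
    have hluvw : l = u ++ v ++ w := by rw [hv, hw, List.take_append_drop]
    rw [← hv] at hAB ha
    clear_value u w
    subst hluvw
    simp only [List.prod_append, c.height_mul] at h0 hAB ha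
    refine ⟨w.prod⁻¹, v.prod⁻¹, u.prod⁻¹, w.length, v.length, u.length, c.height w.prod,
      by simp [mul_assoc], by simp; omega, by omega,
      inv_mem_cayleyBall (list_prod_mem_cayleyBall fun x hx => hl x (by simp [hx])),
      inv_mem_cayleyBall (list_prod_mem_cayleyBall fun x hx => hl x (by simp [hx])),
      inv_mem_cayleyBall (list_prod_mem_cayleyBall fun x hx => hl x (by simp [hx])),
      by simp, by simp; omega, by simp; omega,
      fun j hj => ?_, fun j hj => ?_, fun j hj => ?_, fun j hj => ?_⟩
    · rw [lamp_inv, inv_eq_one]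
      exact hr.lamp_factor_eq_one (u := u ++ v) (v := w) (w := []) (by simpa using hl)
        (by simpa using hAB) (by simp only [List.prod_append, c.height_mul]; omega)
    · rw [lamp_inv, inv_eq_one]
      exact hr.lamp_factor_eq_one hl hAB (by omega)
    · rw [lamp_inv, inv_eq_one]
      exact hr.lamp_factor_eq_one hl hAB (by omega)
    · rw [lamp_inv, inv_eq_one]
      exact hr.lamp_factor_eq_one (u := []) (v := u) (w := v ++ w) (by simpa using hl)
        (by simpa using hAB) (by simp; omega)

theorem tourBall_subset (b n : ℕ) : c.tourBall S r b n ⊆ cayleyBall S n := by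
  rintro g ⟨x, y, z, l₁, l₂, l₃, a, rfl, hl, -, hx, hy, hz, -⟩
  exact cayleyBall_mono hl (mul_mem_cayleyBall (mul_mem_cayleyBall hx hy) hz)

theorem tourBall_mono {b m n : ℕ} (h : m ≤ n) : c.tourBall S r b m ⊆ c.tourBall S r b n := by
  rintro g ⟨x, y, z, l₁, l₂, l₃, a, hg, hl, h'⟩
  exact ⟨x, y, z, l₁, l₂, l₃, a, hg, hl.trans h, h'⟩

/-- Tours with maximum greater than `k` are rare, uniformly in the radius. -/
theorem IsBound.exists_sum_ncard_tourBall_le [Nontrivial H] (hr : c.IsBound S r) (hr0 : 0 ≤ r)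
    (hS : S.Finite) (hgen : Subgroup.closure S = ⊤) :
    ∃ D : ℝ, ∀ k : ℕ, k ≠ 0 → ∀ n m : ℕ,
      ∑ b ∈ Finset.Ioc k m, ((c.tourBall S r b n).ncard : ℝ) ≤
        D / k * (cayleyBall S n).ncard := by
  obtain ⟨h, hh⟩ := exists_ne (1 : H)
  obtain ⟨C, hC⟩ := hr.exists_mul_ncard_tourBall_le hr0 hS hgen hh
  refine ⟨9 * (cayleyBall S C).ncard, fun k hk n m => ?_⟩
  have hball : ((cayleyBall S (n + C)).ncard : ℝ) ≤
      (cayleyBall S n).ncard * (cayleyBall S C).ncard := by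
    exact_mod_cast ncard_cayleyBall_add_le hS n C
  have hterm : ∀ b ∈ Finset.Ioc k m, ((c.tourBall S r b n).ncard : ℝ) ≤
      ((b : ℝ) ^ 2)⁻¹ * (9 * (cayleyBall S (n + C)).ncard) := by
    intro b hb
    rw [Finset.mem_Ioc] at hb
    have hb0 : (0 : ℝ) < b := by exact_mod_cast (by omega : 0 < b)
    rw [← div_eq_inv_mul, le_div_iff₀ (by positivity)]
    -- Holds because `b > k ≥ 1` gives `b ≥ 2`; squaring it produces the constant `9`.
    have h3 : (b : ℝ) ≤ 3 * (b / 2 : ℕ) := by exact_mod_cast (by omega : b ≤ 3 * (b / 2))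
    have h4 : ((b / 2 : ℕ) : ℝ) ^ 2 * (c.tourBall S r b n).ncard ≤
        (cayleyBall S (n + C)).ncard := by exact_mod_cast hC b n
    calc ((c.tourBall S r b n).ncard : ℝ) * (b : ℝ) ^ 2
        ≤ (c.tourBall S r b n).ncard * (3 * (b / 2 : ℕ)) ^ 2 := by gcongr
      _ = 9 * (((b / 2 : ℕ) : ℝ) ^ 2 * (c.tourBall S r b n).ncard) := by ring
      _ ≤ _ := by gcongr
  refine (Finset.sum_le_sum hterm).trans ?_
  rw [← Finset.sum_mul]
  have hsum : ∑ b ∈ Finset.Ioc k m, ((b : ℝ) ^ 2)⁻¹ ≤ (k : ℝ)⁻¹ := by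
    rcases le_total k m with hkm | hkm
    · exact (sum_Ioc_inv_sq_le_sub hk hkm).trans (by simp)
    · rw [Finset.Ioc_eq_empty (by omega), Finset.sum_empty]
      positivity
  calc (∑ b ∈ Finset.Ioc k m, ((b : ℝ) ^ 2)⁻¹) * (9 * ((cayleyBall S (n + C)).ncard : ℝ))
      ≤ (k : ℝ)⁻¹ * (9 * ((cayleyBall S n).ncard * (cayleyBall S C).ncard)) := by gcongr
    _ = _ := by ring

/-! ### Combining the estimates -/

/-- A path leaving `[-k, k]` does so to the right or to the left; the latter case is a tour in the
reflected coordinates. -/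
theorem IsBound.base_inter_cayleyBall_subset (hr : c.IsBound S r) (k M n : ℕ) :
    {g | c.height g = 0} ∩ cayleyBall S n ⊆
      (cayleyBall S M ∪ (c.narrowBall S k n \ c.narrowBall S k M)) ∪
      ⋃ b ∈ Finset.Ioc k (n * r.toNat),
        ((c.tourBall S r b n ∪ (c.tourBall S r b n)⁻¹) ∪
          (c.neg.tourBall S r b n ∪ (c.neg.tourBall S r b n)⁻¹)) := by
  rintro g ⟨hg0, hg⟩
  obtain ⟨l, hln, hl, rfl⟩ := mem_cayleyBall_iff.1 hg
  have hmono : Finset.Ioc k (l.length * r.toNat) ⊆ Finset.Ioc k (n * r.toNat) :=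
    Finset.Ioc_subset_Ioc_right (by gcongr)
  by_cases hnar : ∀ p, p <+: l → |c.height p.prod| ≤ k
  · left
    by_cases hM : l.prod ∈ c.narrowBall S k M
    · exact Or.inl (narrowBall_subset _ _ hM)
    · exact Or.inr ⟨⟨l, hln, hl, rfl, hnar⟩, hM⟩
  · right
    push Not at hnar
    obtain ⟨p, hp, hkp⟩ := hnar
    rw [Set.mem_iUnion₂]
    rcases lt_abs.1 hkp with hkp | hkp
    · obtain ⟨b, hb, h⟩ := hr.exists_mem_tourBall hl hg0 ⟨p, hp, hkp⟩
      exact ⟨b, hmono hb, Or.inl (h.imp (tourBall_mono hln ·) (tourBall_mono hln ·))⟩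
    · obtain ⟨b, hb, h⟩ := hr.neg.exists_mem_tourBall hl (by simpa using hg0) ⟨p, hp, hkp⟩
      exact ⟨b, hmono hb, Or.inr (h.imp (tourBall_mono hln ·) (tourBall_mono hln ·))⟩

/-- The order of quantifiers matters: `D` does not depend on `k`, nor `D'` on `M`, so `k`, then `M`,
then `n` can be chosen large. -/
theorem exists_ballRatio_le [Nontrivial H] (c : LampCoordinates G H) (hS : S.Finite)
    (hgen : Subgroup.closure S = ⊤) :
    ∃ D : ℝ, ∀ k : ℕ, k ≠ 0 → ∃ D' : ℝ, ∀ M : ℕ, M ≠ 0 → ∀ n : ℕ,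
      ballRatio S {g | c.height g = 0} n ≤
        (cayleyBall S M).ncard / (cayleyBall S n).ncard + D' / M + D / k := by
  obtain ⟨r, hr0, hr⟩ := c.exists_isBound hS
  obtain ⟨D₁, hD₁⟩ := hr.exists_sum_ncard_tourBall_le hr0 hS hgen
  obtain ⟨D₂, hD₂⟩ := hr.neg.exists_sum_ncard_tourBall_le hr0 hS hgen
  refine ⟨2 * (D₁ + D₂), fun k hk => ?_⟩
  obtain ⟨C, hC⟩ := hr.exists_mul_ncard_narrowBall_le hS hgen k
  refine ⟨(2 * k + 1) * (cayleyBall S C).ncard, fun M hM n => ?_⟩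
  have hpos : (0 : ℝ) < (cayleyBall S n).ncard := by exact_mod_cast ncard_cayleyBall_pos hS n
  have hfin := cayleyBall_finite hS n
  have hnarrow : ((c.narrowBall S k n \ c.narrowBall S k M).ncard : ℝ) ≤
      (2 * k + 1) * (cayleyBall S C).ncard / M * (cayleyBall S n).ncard := by
    have hM0 : (0 : ℝ) < M := by exact_mod_cast Nat.pos_of_ne_zero hM
    rw [div_mul_eq_mul_div, le_div_iff₀ hM0]
    have h1 : (M : ℝ) * (c.narrowBall S k n \ c.narrowBall S k M).ncard ≤
        (2 * k + 1) * (cayleyBall S (n + C)).ncard := by exact_mod_cast hC M n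
    have h2 : ((cayleyBall S (n + C)).ncard : ℝ) ≤
        (cayleyBall S n).ncard * (cayleyBall S C).ncard := by
      exact_mod_cast ncard_cayleyBall_add_le hS n C
    calc _ = (M : ℝ) * (c.narrowBall S k n \ c.narrowBall S k M).ncard := by ring
      _ ≤ (2 * k + 1) * ((cayleyBall S n).ncard * (cayleyBall S C).ncard) :=
        h1.trans (by gcongr)
      _ = _ := by ring
  have hcover : ({g | c.height g = 0} ∩ cayleyBall S n).ncard ≤
      (cayleyBall S M).ncard + (c.narrowBall S k n \ c.narrowBall S k M).ncard +
        ∑ b ∈ Finset.Ioc k (n * r.toNat), (2 * (c.tourBall S r b n).ncard +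
          2 * (c.neg.tourBall S r b n).ncard) := by
    refine (Set.ncard_le_ncard (hr.base_inter_cayleyBall_subset k M n) ?_).trans
      ((Set.ncard_union_le _ _).trans (add_le_add (Set.ncard_union_le _ _)
        ((Finset.set_ncard_biUnion_le _ _).trans (Finset.sum_le_sum fun b _ => ?_))))
    · refine ((cayleyBall_finite hS M).union
        (hfin.subset (Set.sdiff_subset.trans (narrowBall_subset _ _)))).union
        ((Finset.finite_toSet _).biUnion fun b _ => ?_)
      have h1 := hfin.subset (tourBall_subset (c := c) (S := S) (r := r) b n)
      have h2 := hfin.subset (tourBall_subset (c := c.neg) (S := S) (r := r) b n)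
      exact (h1.union h1.inv).union (h2.union h2.inv)
    · refine (Set.ncard_union_le _ _).trans (add_le_add ?_ ?_) <;>
      · refine (Set.ncard_union_le _ _).trans ?_
        rw [Set.ncard_inv, two_mul]
  have hcover' : (({g | c.height g = 0} ∩ cayleyBall S n).ncard : ℝ) ≤
      (cayleyBall S M).ncard + (c.narrowBall S k n \ c.narrowBall S k M).ncard +
        (2 * ∑ b ∈ Finset.Ioc k (n * r.toNat), ((c.tourBall S r b n).ncard : ℝ) +
          2 * ∑ b ∈ Finset.Ioc k (n * r.toNat), ((c.neg.tourBall S r b n).ncard : ℝ)) := by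
    rw [Finset.mul_sum, Finset.mul_sum, ← Finset.sum_add_distrib]
    exact_mod_cast hcover
  rw [ballRatio, div_le_iff₀ hpos]
  have h1 := hD₁ k hk n (n * r.toNat)
  have h2 := hD₂ k hk n (n * r.toNat)
  have h3 : ((cayleyBall S M).ncard : ℝ) / (cayleyBall S n).ncard * (cayleyBall S n).ncard =
      (cayleyBall S M).ncard := div_mul_cancel₀ _ hpos.ne'
  rw [add_mul, add_mul, h3]
  have h4 : 2 * (D₁ + D₂) / k * ((cayleyBall S n).ncard : ℝ) =
      2 * (D₁ / k * (cayleyBall S n).ncard) + 2 * (D₂ / k * (cayleyBall S n).ncard) := by ring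
  rw [h4]
  linarith

theorem ballRatio_nonneg (X : Set G) (n : ℕ) : 0 ≤ ballRatio S X n := by
  unfold ballRatio
  positivity

theorem tendsto_ballRatio (c : LampCoordinates G H) (hS : S.Finite)
    (hgen : Subgroup.closure S = ⊤) :
    Tendsto (ballRatio S {g | c.height g = 0}) atTop (𝓝 0) := by
  have := c.infinite
  have hball : Tendsto (fun n => ((cayleyBall S n).ncard : ℝ)) atTop atTop :=
    tendsto_natCast_atTop_atTop.comp (tendsto_ncard_cayleyBall hS hgen)
  rcases subsingleton_or_nontrivial H with hH | hH
  -- For trivial `H` there are no lamps to switch, but the base group is trivial and the balls still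
  -- grow.
  · refine squeeze_zero (ballRatio_nonneg _) (fun n => ?_) hball.inv_tendsto_atTop
    rw [Pi.inv_apply, ← one_div, ballRatio]
    gcongr
    refine mod_cast (Set.ncard_le_ncard (t := {1}) ?_).trans (Set.ncard_singleton _).le
    rintro g ⟨hg, -⟩
    exact c.ext _ _ (fun i => Subsingleton.elim _ _) (by simpa using hg)
  obtain ⟨D, hD⟩ := c.exists_ballRatio_le hS hgen
  rw [Metric.tendsto_atTop']
  intro ε hε
  obtain ⟨k, hk, hk0⟩ := (((tendsto_const_div_atTop_nhds_zero_nat D).eventually_lt_const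
    (show 0 < ε / 3 by positivity)).and (eventually_ne_atTop 0)).exists
  obtain ⟨D', hD'⟩ := hD k hk0
  obtain ⟨M, hM, hM0⟩ := (((tendsto_const_div_atTop_nhds_zero_nat D').eventually_lt_const
    (show 0 < ε / 3 by positivity)).and (eventually_ne_atTop 0)).exists
  obtain ⟨N, hN⟩ := eventually_atTop.1 ((hball.const_div_atTop
    ((cayleyBall S M).ncard : ℝ)).eventually_lt_const (show 0 < ε / 3 by positivity))
  refine ⟨N, fun n hn => ?_⟩
  rw [Real.dist_0_eq_abs, abs_of_nonneg (ballRatio_nonneg _ _)]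
  have h1 := hD' M hM0 n
  have h2 := hN n hn.le
  linarith

/-! ### Application to the wreath product -/

/-- The coordinates of the restricted wreath product with an infinite cyclic top group. -/
def ofMulEquiv {H T : Type*} [Group H] [Group T] (e : Multiplicative ℤ ≃* T) :
    LampCoordinates (restrictedWreathProduct H T) H where
  lamp g i := g.1.left (e (Multiplicative.ofAdd i))
  height g := (e.symm g.1.right).toAdd
  lamp_mul g g' i := by
    simp only [Subgroup.coe_mul, RegularWreathProduct.mul_left, Pi.mul_apply, ofAdd_sub,
      ofAdd_toAdd, map_div, MulEquiv.apply_symm_apply]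
    congr 2
    -- Commutativity is borrowed from ℤ through `e`.
    rw [← e.apply_symm_apply g.1.right, ← map_inv, ← map_mul, ← map_div, div_eq_mul_inv, mul_comm]
  height_mul g g' := by simp
  ext g g' h1 h2 := by
    refine Subtype.ext (RegularWreathProduct.ext (funext fun x => ?_)
      (e.symm.injective (Multiplicative.toAdd.injective h2)))
    simpa using h1 (e.symm x).toAdd
  finite_support g := g.2.preimage (e.injective.comp Multiplicative.ofAdd.injective).injOn
  exists_eq f d hf := by
    refine ⟨⟨⟨fun x => f (e.symm x).toAdd, e (Multiplicative.ofAdd d)⟩,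
      hf.preimage (Multiplicative.toAdd.injective.comp e.symm.injective).injOn⟩, ?_, ?_⟩
    · ext i
      simp
    · simp

end LampCoordinates

theorem theoremB {H T : Type*} [Group H] [Group T] [Group.FG H] [IsCyclic T] [Infinite T]
    (S : Set (restrictedWreathProduct H T)) (hfin : S.Finite) (hgen : Subgroup.closure S = ⊤) :
    density S (baseGroup H T : Set (restrictedWreathProduct H T)) = 0 ∧
      Tendsto (fun n : ℕ => ballRatio S (baseGroup H T : Set (restrictedWreathProduct H T)) n)
        atTop (𝓝 0) := by
  obtain ⟨t, ht⟩ := IsCyclic.exists_zpow_surjective (G := T)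
  have htop : Subgroup.zpowers t = ⊤ := (Subgroup.eq_top_iff' _).2 ht
  let c : LampCoordinates (restrictedWreathProduct H T) H :=
    LampCoordinates.ofMulEquiv (intEquivOfZPowersEqTop t htop)
  have hbase : (baseGroup H T : Set (restrictedWreathProduct H T)) = {g | c.height g = 0} := by
    ext g
    change g.1.right = 1 ↔ ((intEquivOfZPowersEqTop t htop).symm g.1.right).toAdd = 0
    rw [toAdd_eq_zero, MulEquiv.map_eq_one_iff]
  have hlim := c.tendsto_ballRatio hfin hgen
  rw [← hbase] at hlim
  exact ⟨hlim.limsup_eq, hlim⟩
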